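/- Let $A(z),B(z)\in\mathbb{C}[z]$ be non-zero complex polynomials with $\deg(A(z)B(z))\ge 1$, let $k>\ell\ge 1$ be coprime integers, and let $(P_n(z))_{n\ge 0}$ be the sequence of polynomials in $\mathbb{C}[z]$ defined by the identity of formal power series $$\sum_{n\ge 0}P_n(z)\,t^n=\frac{1}{1+B(z)t^{\ell}+A(z)t^{k}} .$$ Let $z_0\in\mathbb{C}$ be a zero of some $P_n$ that is not the zero polynomial, and suppose that $A(z_0)\ne 0$. Then the trinomial $D(t;z_0)=A(z_0)t^k+B(z_0)t^\ell+1$ has two distinct zeros $t_1\neq t_2$ in $\mathbb{C}$ (necessarily non-zero) such that the ratio $t_1/t_2$ is real or satisfies $|t_1/t_2|=1$ (possibly both). -/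

import Mathlib

/-- The denominator `1 + B(z) t^ℓ + A(z) t^k`, as a formal power series in `t`
with coefficients in `ℂ[z]`. -/
noncomputable def genDenom (A B : Polynomial ℂ) (k l : ℕ) : PowerSeries (Polynomial ℂ) :=
  1 + PowerSeries.C B * PowerSeries.X ^ l + PowerSeries.C A * PowerSeries.X ^ k

/-- The polynomial sequence `P_n` generated by `1 / (1 + B(z) t^ℓ + A(z) t^k)`:
`P_n` is the coefficient of `t^n` in the inverse of this series in `ℂ[z]⟦t⟧`.
(For `k, ℓ ≥ 1` the constant coefficient of the denominator is `1`, see `genDenom_mul_mk_genPoly`.) -/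
noncomputable def genPoly (A B : Polynomial ℂ) (k l n : ℕ) : Polynomial ℂ :=
  PowerSeries.coeff n (PowerSeries.invOfUnit (genDenom A B k l) 1)

/-- The trinomial `D(t; z₀) = A(z₀) t^k + B(z₀) t^ℓ + 1`, as a polynomial in `t` over `ℂ`. -/
noncomputable def trinomialAt (A B : Polynomial ℂ) (k l : ℕ) (z₀ : ℂ) : Polynomial ℂ :=
  Polynomial.C (A.eval z₀) * Polynomial.X ^ k + Polynomial.C (B.eval z₀) * Polynomial.X ^ l + 1

/-- The series `∑ P_n(z) t^n` is indeed the reciprocal of `1 + B(z) t^ℓ + A(z) t^k`. -/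
theorem genDenom_mul_mk_genPoly (A B : Polynomial ℂ) {k l : ℕ} (hl : 1 ≤ l) (hk : 1 ≤ k) :
    genDenom A B k l * PowerSeries.mk (genPoly A B k l) = 1 := by
  have h : PowerSeries.mk (genPoly A B k l) = PowerSeries.invOfUnit (genDenom A B k l) 1 := by
    ext1 n
    simp [genPoly]
  rw [h]
  apply PowerSeries.mul_invOfUnit
  simp [genDenom, show l ≠ 0 by omega, show k ≠ 0 by omega]

/-! Choose `μ` with `-A(z₀) μ ^ k = 1` and put `β = -B(z₀) μ ^ l`. Then `d n = P_n(z₀) μ ^ n`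
satisfies `d n = β d (n - l) + d (n - k)` for `n > 0`.

If `β ^ k` is not real, the terms added by this recurrence cannot cancel unless both vanish
(`eq_zero_of_trinomial_recurrence`). A zero of `P_n` at `z₀` thus descends to `P_(n-l)` and
`P_(n-k)`, and induction gives `P_n = 0` (`genPoly_eq_zero_of_isRoot`).

So `β ^ k` is real. Then some map `t ↦ ζ * conj t` with `‖ζ‖ = 1` preserves the roots of the
trinomial (`exists_conj_eq_mul_pow`). A root that it moves has the same modulus as its image; if all
roots are fixed, their ratios are real. A single root would force `D = (1 - t / r) ^ 2`, where
`P_n(z₀) = (n + 1) / r ^ n ≠ 0`. -/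

/-! ### Turning sequences -/

open ComplexConjugate in
/-- A bi-infinite complex sequence that is multiplied by `w` after `k` steps, and whose terms turn
clockwise, by at most a half-turn within each period. -/
structure IsTurning (k : ℤ) (w : ℂ) (f : ℤ → ℂ) : Prop where
  shift : ∀ i, f (i + k) = w * f i
  im_nonneg : ∀ i j, i ≤ j → j ≤ i + k → 0 ≤ (f i * conj (f j)).im

open ComplexConjugate in
theorem im_mul_conj_mul_self_nonneg {w : ℂ} (hw : w.im < 0) (z : ℂ) :
    0 ≤ (z * conj (w * z)).im := by
  have : (z * conj (w * z)).im = -w.im * (z.re ^ 2 + z.im ^ 2) := by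
    simp only [map_mul, Complex.mul_im, Complex.mul_re, Complex.conj_re, Complex.conj_im]
    ring
  rw [this]
  have : 0 < -w.im := by linarith
  positivity

/-- If `f i = -z` with `z = f (i - 1)`, comparing `f i` with `f (i - 1 + k) = w * z` gives `0 ≤ w.im
* |z| ^ 2`. -/
theorem IsTurning.eq_zero_of_add_eq_zero {k : ℤ} (hk : 1 ≤ k) {w : ℂ} (hw : w.im < 0) {f : ℤ → ℂ}
    (hf : IsTurning k w f) {i : ℤ} (h : f i + f (i - 1) = 0) : f i = 0 ∧ f (i - 1) = 0 := by
  have h1 := hf.im_nonneg i (i - 1 + k) (by omega) (by omega)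
  have h2 : f i = -f (i - 1) := eq_neg_of_add_eq_zero_left h
  rw [hf.shift, h2] at h1
  generalize f (i - 1) = z at *
  have h3 : (-z * (starRingEnd ℂ) (w * z)).im = w.im * Complex.normSq z := by
    simp only [map_mul, Complex.mul_im, Complex.mul_re, Complex.conj_re, Complex.conj_im,
      Complex.normSq_apply, Complex.neg_re, Complex.neg_im]
    ring
  have h4 : z = 0 := by
    rw [← Complex.normSq_eq_zero]
    have := Complex.normSq_nonneg z
    nlinarith
  simp [h2, h4]

/-- The sum `f i + f (i - 1)` points between its two neighbouring summands, so the order of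
directions survives. The ends `j = i` and `j = i + k` are separate because there the shifted index
leaves the allowed range. -/
theorem IsTurning.add_pred {k : ℤ} {w : ℂ} (hw : w.im < 0) {f g : ℤ → ℂ}
    (hf : IsTurning k w f) {r : ℤ} (hg : ∀ i, i ≡ r [ZMOD k] → g i = f i + f (i - 1))
    (hg' : ∀ i, ¬ i ≡ r [ZMOD k] → g i = f i) : IsTurning k w g := by
  have hper : ∀ i, (i + k ≡ r [ZMOD k]) ↔ (i ≡ r [ZMOD k]) := fun i => by
    simp [Int.ModEq]
  have shift : ∀ i, g (i + k) = w * g i := by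
    intro i
    by_cases hi : i ≡ r [ZMOD k]
    · rw [hg _ hi, hg _ ((hper i).2 hi), hf.shift, show i + k - 1 = i - 1 + k by ring, hf.shift]
      ring
    · rw [hg' _ hi, hg' _ (fun h => hi ((hper i).1 h)), hf.shift]
  refine ⟨shift, fun i j hij hji => ?_⟩
  rcases eq_or_lt_of_le hij with rfl | hij'
  · rw [Complex.mul_conj]; simp
  rcases eq_or_lt_of_le hji with rfl | hji'
  · rw [shift]; exact im_mul_conj_mul_self_nonneg hw _
  by_cases hi : i ≡ r [ZMOD k]
  · have hj : ¬ j ≡ r [ZMOD k] := by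
      intro hj
      have h1 : k ∣ j - i := (hi.trans hj.symm).dvd
      have := Int.le_of_dvd (by omega) h1
      omega
    rw [hg _ hi, hg' _ hj, add_mul, Complex.add_im]
    exact add_nonneg (hf.im_nonneg _ _ hij hji) (hf.im_nonneg _ _ (by omega) (by omega))
  · by_cases hj : j ≡ r [ZMOD k]
    · rw [hg' _ hi, hg _ hj, map_add, mul_add, Complex.add_im]
      exact add_nonneg (hf.im_nonneg _ _ hij hji) (hf.im_nonneg _ _ (by omega) (by omega))
    · rw [hg' _ hi, hg' _ hj]
      exact hf.im_nonneg _ _ hij hji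

/-! ### Sliding a window along the recurrence -/

/-- The terms of `d` in the window `(N, N + k]`, arranged by the residue `i` with index `≡ l * i`,
and rescaled by `β ^ (-i)`. -/
noncomputable def windowSeq (k l : ℤ) (β : ℂ) (d : ℤ → ℂ) (N i : ℤ) : ℂ :=
  β ^ (-i) * d (N + 1 + (l * i - N - 1) % k)

theorem windowSeq_eq {k l : ℤ} {β : ℂ} {d : ℤ → ℂ} {N i n : ℤ} (h1 : N < n) (h2 : n ≤ N + k)
    (h : l * i ≡ n [ZMOD k]) : windowSeq k l β d N i = β ^ (-i) * d n := by
  have : (l * i - N - 1) % k = n - N - 1 := by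
    have h3 : l * i - N - 1 ≡ n - N - 1 [ZMOD k] := (h.sub_right N).sub_right 1
    rw [h3.eq, Int.emod_eq_of_lt] <;> omega
  rw [windowSeq, this]
  congr 2
  ring

/-- The window drops `d (N + 1)` and gains `d (N + 1 + k)`. The rescaling absorbs `β`, and the term
`l` indices earlier sits at position `i - 1`. -/
theorem windowSeq_succ_of_modEq {k l : ℤ} (hl : 1 ≤ l) (hlk : l < k) {β : ℂ} (hβ : β ≠ 0)
    {d : ℤ → ℂ} {N i : ℤ} (h : l * i ≡ N + 1 [ZMOD k])
    (hd : d (N + 1 + k) = β * d (N + 1 + k - l) + d (N + 1)) :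
    windowSeq k l β d (N + 1) i = windowSeq k l β d N i + windowSeq k l β d N (i - 1) := by
  have e : N + 1 ≡ N + 1 + k [ZMOD k] := by simp [Int.ModEq]
  have h' : l * (i - 1) ≡ N + 1 + k - l [ZMOD k] := by
    rw [mul_sub, mul_one]; exact (h.trans e).sub_right l
  rw [windowSeq_eq (n := N + 1 + k) (by omega) (by omega) (h.trans e),
    windowSeq_eq (n := N + 1) (by omega) (by omega) h,
    windowSeq_eq (n := N + 1 + k - l) (by omega) (by omega) h', hd,
    show -(i - 1) = -i + 1 by ring, zpow_add₀ hβ, zpow_one]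
  ring

theorem windowSeq_succ_of_not_modEq {k l : ℤ} (hk : 1 ≤ k) {β : ℂ}
    {d : ℤ → ℂ} {N i : ℤ} (h : ¬ l * i ≡ N + 1 [ZMOD k]) :
    windowSeq k l β d (N + 1) i = windowSeq k l β d N i := by
  have h0 := Int.emod_nonneg (l * i - N - 1) (show k ≠ 0 by omega)
  have h1 := Int.emod_lt_of_pos (l * i - N - 1) (show 0 < k by omega)
  have h2 : (l * i - N - 1) % k ≠ 0 := by
    intro h3
    apply h
    rw [Int.modEq_comm, Int.modEq_iff_dvd]
    have := Int.dvd_of_emod_eq_zero h3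
    rwa [show l * i - (N + 1) = l * i - N - 1 by ring]
  have h4 : l * i ≡ N + 1 + (l * i - N - 1) % k [ZMOD k] := by
    have := (Int.mod_modEq (l * i - N - 1) k).symm.add_left (N + 1)
    rwa [show N + 1 + (l * i - N - 1) = l * i by ring] at this
  rw [windowSeq_eq (n := N + 1 + (l * i - N - 1) % k) (by omega) (by omega) h4, windowSeq]

theorem isTurning_windowSeq {k l : ℤ} (hl : 1 ≤ l) (hlk : l < k) (hcop : IsCoprime k l) {β : ℂ}
    (hβ : β ≠ 0) (hw : (β ^ (-k)).im < 0) {d : ℤ → ℂ} (hneg : ∀ n < 0, d n = 0)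
    (hd : ∀ n > 0, d n = β * d (n - l) + d (n - k)) (m : ℕ) :
    IsTurning k (β ^ (-k)) (windowSeq k l β d (-k + m)) := by
  induction m with
  | zero =>
    -- In the initial window `(-k, 0]` only `d 0` can be nonzero; it occupies the multiples of `k`.
    have hval0 : ∀ i, ¬ k ∣ i → windowSeq k l β d (-k) i = 0 := by
      intro i hi
      have h0 := Int.emod_nonneg (l * i - -k - 1) (show k ≠ 0 by omega)
      have h1 := Int.emod_lt_of_pos (l * i - -k - 1) (show 0 < k by omega)
      rw [windowSeq, hneg, mul_zero]
      by_contra h2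
      apply hi
      have h3 : (l * i - -k - 1) % k = k - 1 := by omega
      have h4 : k ∣ (l * i - -k - 1) - (k - 1) := by
        rw [← h3]; exact Int.dvd_self_sub_emod
      rw [show (l * i - -k - 1) - (k - 1) = l * i by ring] at h4
      exact hcop.dvd_of_dvd_mul_left h4
    have hshift : ∀ i, windowSeq k l β d (-k) (i + k) = β ^ (-k) * windowSeq k l β d (-k) i := by
      intro i
      rw [windowSeq, windowSeq, show -(i + k) = -k + -i by ring, zpow_add₀ hβ,
        show l * (i + k) - -k - 1 = l * i - -k - 1 + k * l by ring, Int.add_mul_emod_self_left]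
      ring
    rw [Nat.cast_zero, add_zero]
    refine ⟨hshift, fun i j hij hji => ?_⟩
    by_cases hi : k ∣ i
    · by_cases hj : k ∣ j
      · rcases eq_or_lt_of_le hij with rfl | hij'
        · rw [Complex.mul_conj]; simp
        have := Int.le_of_dvd (by omega) (dvd_sub hj hi)
        obtain rfl : j = i + k := by omega
        rw [hshift]
        exact im_mul_conj_mul_self_nonneg hw _
      · simp [hval0 j hj]
    · simp [hval0 i hi]
  | succ m ih =>
    obtain ⟨u, v, huv⟩ := id hcop
    -- `v` inverts `l` modulo `k`, so the updated positions form a single residue class.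
    have hr : ∀ i, (i ≡ v * (-k + m + 1) [ZMOD k]) ↔ l * i ≡ -k + m + 1 [ZMOD k] := by
      have hvl : v * l ≡ 1 [ZMOD k] := by
        rw [Int.modEq_iff_dvd]; exact ⟨u, by linarith⟩
      intro i
      constructor
      · intro h
        have h1 := h.mul_left l
        have h2 := hvl.mul_right (-k + m + 1)
        rw [one_mul] at h2
        refine h1.trans ?_
        rwa [show l * (v * (-k + m + 1)) = v * l * (-k + m + 1) by ring]
      · intro h
        have h1 := h.mul_left v
        have h2 := (hvl.mul_right i).symm
        rw [one_mul, mul_assoc] at h2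
        exact h2.trans h1
    rw [Nat.cast_succ, ← add_assoc]
    refine ih.add_pred hw (r := v * (-k + m + 1)) (fun i hi => ?_) (fun i hi => ?_)
    · refine windowSeq_succ_of_modEq hl hlk hβ ((hr i).1 hi) ?_
      rw [hd _ (by omega)]
      congr 2
      ring
    · exact windowSeq_succ_of_not_modEq (by omega) (fun h => hi ((hr i).2 h))

theorem eq_zero_of_trinomial_recurrence_of_im_pos {k l : ℤ} (hl : 1 ≤ l) (hlk : l < k)
    (hcop : IsCoprime k l) {β : ℂ} (hβ : 0 < (β ^ k).im) {d : ℤ → ℂ} (hneg : ∀ n < 0, d n = 0)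
    (hd : ∀ n > 0, d n = β * d (n - l) + d (n - k)) {n : ℤ} (hn : 0 < n) (h : d n = 0) :
    d (n - l) = 0 ∧ d (n - k) = 0 := by
  have hβ0 : β ≠ 0 := by
    rintro rfl
    rw [zero_zpow _ (by omega)] at hβ
    simp at hβ
  have hw : (β ^ (-k)).im < 0 := by
    rw [zpow_neg, Complex.inv_im]
    have : 0 < Complex.normSq (β ^ k) := Complex.normSq_pos.2 (zpow_ne_zero _ hβ0)
    exact div_neg_of_neg_of_pos (by linarith) this
  obtain ⟨u, v, huv⟩ := id hcop
  have hT := isTurning_windowSeq hl hlk hcop hβ0 hw hneg hd (n - 1).toNat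
  -- The window `(n - k - 1, n - 1]` contains both `n - k` and `n - l`, at the adjacent positions `v
  -- * n` and `v * n - 1`.
  rw [show -k + ((n - 1).toNat : ℤ) = n - k - 1 by omega] at hT
  have h1 : l * (v * n) ≡ n - k [ZMOD k] := by
    rw [Int.modEq_iff_dvd]
    exact ⟨u * n - 1, by linear_combination (-n) * huv⟩
  have h2 : l * (v * n - 1) ≡ n - l [ZMOD k] := by
    rw [Int.modEq_iff_dvd]
    exact ⟨u * n, by linear_combination (-n) * huv⟩
  have key := hT.eq_zero_of_add_eq_zero (by omega) hw (i := v * n) (by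
    rw [windowSeq_eq (n := n - k) (by omega) (by omega) h1,
      windowSeq_eq (n := n - l) (by omega) (by omega) h2,
      show -(v * n - 1) = -(v * n) + 1 by ring, zpow_add₀ hβ0, zpow_one, mul_assoc, ← mul_add,
      add_comm, ← hd n hn, h, mul_zero])
  rw [windowSeq_eq (n := n - k) (by omega) (by omega) h1,
    windowSeq_eq (n := n - l) (by omega) (by omega) h2] at key
  simp only [mul_eq_zero, zpow_ne_zero _ hβ0, false_or] at key
  exact ⟨key.2, key.1⟩

theorem eq_zero_of_trinomial_recurrence {k l : ℤ} (hl : 1 ≤ l) (hlk : l < k)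
    (hcop : IsCoprime k l) {β : ℂ} (hβ : (β ^ k).im ≠ 0) {d : ℤ → ℂ} (hneg : ∀ n < 0, d n = 0)
    (hd : ∀ n > 0, d n = β * d (n - l) + d (n - k)) {n : ℤ} (hn : 0 < n) (h : d n = 0) :
    d (n - l) = 0 ∧ d (n - k) = 0 := by
  rcases lt_or_gt_of_ne hβ with hβ | hβ
  -- Conjugating the whole recurrence flips the sign of the imaginary part.
  · have := eq_zero_of_trinomial_recurrence_of_im_pos hl hlk hcop (β := starRingEnd ℂ β)
      (d := fun n => starRingEnd ℂ (d n)) (by rw [← map_zpow₀, Complex.conj_im]; linarith)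
      (fun n hn => by simp [hneg n hn]) (fun n hn => by simp [hd n hn]) hn (by simp [h])
    simpa using this
  · exact eq_zero_of_trinomial_recurrence_of_im_pos hl hlk hcop hβ hneg hd hn h

theorem exists_pow_eq_and_pow_eq {K : Type*} [Field K] {k l : ℕ} (hcop : Nat.Coprime k l) {u v : K}
    (hu : u ≠ 0) (hv : v ≠ 0) (h : v ^ k = u ^ l) : ∃ z : K, z ^ k = u ∧ z ^ l = v := by
  obtain ⟨m, m', hm⟩ := Nat.isCoprime_iff_coprime.2 hcop
  have h' : v ^ (k : ℤ) = u ^ (l : ℤ) := by simpa using h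
  refine ⟨u ^ m * v ^ m', ?_, ?_⟩
  · rw [← zpow_natCast, mul_zpow, ← zpow_mul, ← zpow_mul, mul_comm m' k, zpow_mul v, h',
      ← zpow_mul, ← zpow_add₀ hu, mul_comm (l : ℤ), hm, zpow_one]
  · rw [← zpow_natCast, mul_zpow, ← zpow_mul, ← zpow_mul, mul_comm m l, zpow_mul u, ← h',
      ← zpow_mul, ← zpow_add₀ hv, mul_comm (k : ℤ), hm, zpow_one]

/-! ### Descent for the polynomials `P_n` -/

theorem genPoly_zero (A B : Polynomial ℂ) (k l : ℕ) : genPoly A B k l 0 = 1 := by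
  simp [genPoly]

theorem genPoly_recurrence (A B : Polynomial ℂ) {k l : ℕ} (hl : 1 ≤ l) (hk : 1 ≤ k) {n : ℕ}
    (hn : n ≠ 0) :
    genPoly A B k l n + B * (if l ≤ n then genPoly A B k l (n - l) else 0)
      + A * (if k ≤ n then genPoly A B k l (n - k) else 0) = 0 := by
  have h := congrArg (PowerSeries.coeff n) (genDenom_mul_mk_genPoly A B hl hk)
  simpa [genDenom, add_mul, mul_assoc, PowerSeries.coeff_X_pow_mul', PowerSeries.coeff_one, hn]
    using h

theorem genPoly_eq_zero_of_isRoot {A B : Polynomial ℂ} {k l : ℕ} (hl : 1 ≤ l) (hlk : l < k)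
    (hcop : Nat.Coprime k l) {z₀ μ : ℂ} (hμ : -A.eval z₀ * μ ^ k = 1)
    (him : ((-B.eval z₀ * μ ^ l) ^ k).im ≠ 0) (n : ℕ) (h : (genPoly A B k l n).IsRoot z₀) :
    genPoly A B k l n = 0 := by
  have hμ0 : μ ≠ 0 := by
    rintro rfl
    rw [zero_pow (by omega)] at hμ
    simp at hμ
  -- Extension by zero makes one recurrence valid for all `n > 0`; the factor `μ ^ n` normalizes the
  -- coefficient of `d (n - k)` to `1`.
  set d : ℤ → ℂ := fun n => if 0 ≤ n then (genPoly A B k l n.toNat).eval z₀ * μ ^ n else 0 with hd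
  have hneg : ∀ n < 0, d n = 0 := fun n hn => by simp [hd, not_le.2 hn]
  have hnat : ∀ n : ℕ, d n = (genPoly A B k l n).eval z₀ * μ ^ n := fun n => by simp [hd]
  have hsub : ∀ n m : ℕ, d ((n : ℤ) - m) * μ ^ m =
      (if m ≤ n then genPoly A B k l (n - m) else 0).eval z₀ * μ ^ n := by
    intro n m
    split_ifs with hm
    · rw [← Nat.cast_sub hm, hnat, mul_assoc, ← pow_add, Nat.sub_add_cancel hm]
    · rw [hneg _ (by omega)]; simp
  have hrec : ∀ n > 0, d n = (-B.eval z₀ * μ ^ l) * d (n - l) + d (n - k) := by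
    intro n hn
    lift n to ℕ using hn.le
    have h1 := congrArg (Polynomial.eval z₀)
      (genPoly_recurrence A B hl (k := k) (by omega) (n := n) (by omega))
    rw [Polynomial.eval_add, Polynomial.eval_add, Polynomial.eval_mul, Polynomial.eval_mul,
      Polynomial.eval_zero] at h1
    rw [hnat]
    linear_combination μ ^ n * h1 + B.eval z₀ * hsub n l + A.eval z₀ * hsub n k
      + d (n - k) * hμ
  induction n using Nat.strong_induction_on with
  | _ n ih =>
    rcases Nat.eq_zero_or_pos n with rfl | hn
    · simp [genPoly_zero] at h
    have h0 : d n = 0 := by rw [hnat, h.eq_zero, zero_mul]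
    obtain ⟨h1, h2⟩ := eq_zero_of_trinomial_recurrence (by omega) (by omega)
      (Nat.isCoprime_iff_coprime.2 hcop) (by simpa using him) hneg hrec (n := n) (by omega) h0
    have hz : ∀ m : ℕ, 1 ≤ m → d ((n : ℤ) - m) = 0 →
        (if m ≤ n then genPoly A B k l (n - m) else 0) = 0 := by
      intro m hm hdm
      split_ifs with hmn
      · refine ih _ (by omega) ?_
        rw [← Nat.cast_sub hmn, hnat] at hdm
        exact (mul_eq_zero.1 hdm).resolve_right (pow_ne_zero _ hμ0)
      · rfl
    have h3 := genPoly_recurrence A B hl (k := k) (by omega) hn.ne'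
    rwa [hz l hl h1, hz k (by omega) h2, mul_zero, mul_zero, add_zero, add_zero] at h3

/-! ### Roots of the trinomial -/

theorem eval_trinomialAt (A B : Polynomial ℂ) (k l : ℕ) (z₀ t : ℂ) :
    (trinomialAt A B k l z₀).eval t = A.eval z₀ * t ^ k + B.eval z₀ * t ^ l + 1 := by
  simp [trinomialAt]

theorem natDegree_trinomialAt {A B : Polynomial ℂ} {k l : ℕ} (hlk : l < k) {z₀ : ℂ}
    (hA : A.eval z₀ ≠ 0) : (trinomialAt A B k l z₀).natDegree = k := by
  unfold trinomialAt
  compute_degree!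
  · simp [hA, hlk.ne', show k ≠ 0 by omega]
  all_goals omega

open ComplexConjugate in
/-- A trinomial that is real up to a rotation of the variable and has two distinct roots has two
distinct roots whose ratio is real or of modulus one. -/
theorem exists_roots_of_conj_eq {A B : Polynomial ℂ} {k l : ℕ} {z₀ ζ : ℂ}
    (hk : k ≠ 0) (hA : A.eval z₀ ≠ 0) (hζA : conj (A.eval z₀) = A.eval z₀ * ζ ^ k)
    (hζB : conj (B.eval z₀) = B.eval z₀ * ζ ^ l) {r s : ℂ} (hrs : r ≠ s)
    (hr : (trinomialAt A B k l z₀).IsRoot r) (hs : (trinomialAt A B k l z₀).IsRoot s) :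
    ∃ t₁ t₂ : ℂ, t₁ ≠ t₂ ∧
      (trinomialAt A B k l z₀).IsRoot t₁ ∧ (trinomialAt A B k l z₀).IsRoot t₂ ∧
      ((t₁ / t₂).im = 0 ∨ ‖t₁ / t₂‖ = 1) := by
  have hζ : ‖ζ‖ = 1 := by
    have h := congrArg norm hζA
    rw [RCLike.norm_conj, norm_mul, norm_pow] at h
    have h1 : ‖ζ‖ ^ k = 1 := by
      have := norm_ne_zero_iff.2 hA
      exact mul_left_cancel₀ this (by rw [← h, mul_one])
    exact (pow_eq_one_iff_of_nonneg (norm_nonneg _) hk).1 h1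
  have hζ0 : ζ ≠ 0 := by rw [← norm_ne_zero_iff, hζ]; exact one_ne_zero
  have hrefl : ∀ t, (trinomialAt A B k l z₀).IsRoot t →
      (trinomialAt A B k l z₀).IsRoot (ζ * conj t) := by
    intro t ht
    rw [Polynomial.IsRoot, eval_trinomialAt] at ht ⊢
    have h := congrArg conj ht
    simp only [map_add, map_mul, map_pow, map_one, map_zero, hζA, hζB] at h
    linear_combination h
  by_cases h : ∃ t, (trinomialAt A B k l z₀).IsRoot t ∧ ζ * conj t ≠ t
  · obtain ⟨t, ht, htne⟩ := h
    refine ⟨ζ * conj t, t, htne, hrefl t ht, ht, Or.inr ?_⟩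
    have : t ≠ 0 := by rintro rfl; simp at htne
    rw [norm_div, norm_mul, RCLike.norm_conj, hζ, one_mul, div_self (norm_ne_zero_iff.2 this)]
  · push Not at h
    refine ⟨r, s, hrs, hr, hs, Or.inl ?_⟩
    rw [← Complex.conj_eq_iff_im, map_div₀]
    conv_rhs => rw [← h r hr, ← h s hs]
    rw [mul_div_mul_left _ _ hζ0]

theorem eq_two_of_forall_root_eq {A B : Polynomial ℂ} {k l : ℕ} (hl : 1 ≤ l) (hlk : l < k)
    {z₀ r : ℂ} (hA : A.eval z₀ ≠ 0)
    (h : ∀ s, (trinomialAt A B k l z₀).IsRoot s → s = r) :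
    k = 2 ∧ B.eval z₀ = -2 * A.eval z₀ * r ∧ A.eval z₀ * r ^ 2 = 1 := by
  have hdeg := natDegree_trinomialAt (B := B) hlk hA
  have hlead : (trinomialAt A B k l z₀).leadingCoeff = A.eval z₀ := by
    rw [Polynomial.leadingCoeff, hdeg]
    simp [trinomialAt, Polynomial.coeff_X_pow, Polynomial.coeff_one, hlk.ne', show k ≠ 0 by omega]
  have hsp := IsAlgClosed.splits (trinomialAt A B k l z₀)
  have hroots : (trinomialAt A B k l z₀).roots = Multiset.replicate k r := by
    rw [Multiset.eq_replicate]
    refine ⟨?_, fun s hs => h s (Polynomial.isRoot_of_mem_roots hs)⟩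
    exact hsp.natDegree_eq_card_roots.symm.trans hdeg
  have hfac : trinomialAt A B k l z₀ =
      Polynomial.C (A.eval z₀) * (Polynomial.X - Polynomial.C r) ^ k := by
    have h1 := hsp.eq_prod_roots
    rwa [hroots, hlead, Multiset.map_replicate, Multiset.prod_replicate] at h1
  have hcoeff : ∀ m, (trinomialAt A B k l z₀).coeff m =
      A.eval z₀ * ((-r) ^ (k - m) * (k.choose m)) := by
    intro m
    rw [hfac, Polynomial.coeff_C_mul, sub_eq_add_neg, ← Polynomial.C_neg,
      Polynomial.coeff_X_add_C_pow]
  have h0 := hcoeff 0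
  have hr : r ≠ 0 := by
    rintro rfl
    simp [trinomialAt, Polynomial.coeff_X_pow, show k ≠ 0 by omega,
      show 0 ≠ k by omega, show 0 ≠ l by omega] at h0
  -- All coefficients of `(X - r) ^ k` up to degree `k` are nonzero, while the trinomial has only
  -- `l` as intermediate exponent.
  have hmid : ∀ m, m ≠ 0 → m < k → m = l := by
    intro m hm hmk
    by_contra hml
    have h1 := hcoeff m
    simp [trinomialAt, Polynomial.coeff_X_pow, Polynomial.coeff_one, hm, hmk.ne, hml, hr, hA,
      Nat.choose_eq_zero_iff] at h1
    omega
  have h1 := hmid 1 one_ne_zero (by omega)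
  have hk : k = 2 := by
    by_contra hk
    have := hmid 2 two_ne_zero (by omega)
    omega
  subst h1 hk
  have h1 := hcoeff 1
  simp [trinomialAt, Polynomial.coeff_X_pow, Polynomial.coeff_one] at h0 h1
  refine ⟨rfl, ?_, h0.symm⟩
  rw [h1]; ring

theorem eval_genPoly_two_one {A B : Polynomial ℂ} {z₀ r : ℂ}
    (hB : B.eval z₀ = -2 * A.eval z₀ * r) (hA : A.eval z₀ * r ^ 2 = 1) (n : ℕ) :
    (genPoly A B 2 1 n).eval z₀ * r ^ n = n + 1 := by
  induction n using Nat.strong_induction_on with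
  | _ n ih =>
    match n with
    | 0 => simp [genPoly_zero]
    | 1 =>
      have h := congrArg (Polynomial.eval z₀)
        (genPoly_recurrence A B (k := 2) (l := 1) le_rfl (by omega) one_ne_zero)
      simp [genPoly_zero] at h
      push_cast
      linear_combination r * h - r * hB + 2 * hA
    | n + 2 =>
      have h := congrArg (Polynomial.eval z₀)
        (genPoly_recurrence A B (k := 2) (l := 1) le_rfl (by omega) (n := n + 2) (by omega))
      simp at h
      have h1 := ih (n + 1) (by omega)
      have h0 := ih n (by omega)
      push_cast at h1 ⊢
      rw [hB] at h
      linear_combination r ^ (n + 2) * h + 2 * A.eval z₀ * r ^ 2 * h1 - A.eval z₀ * r ^ 2 * h0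
        + (n + 3) * hA

open ComplexConjugate in
-- Reality of `(-b) ^ k / (-a) ^ l` is the compatibility condition for solving `ζ ^ k = conj a / a`
-- and `ζ ^ l = conj b / b` together, by Bézout. For `b = 0` the second equation is void.
theorem exists_conj_eq_mul_pow {k l : ℕ} (hk : k ≠ 0) (hcop : Nat.Coprime k l) {a b μ : ℂ}
    (hμ : -a * μ ^ k = 1) (him : ((-b * μ ^ l) ^ k).im = 0) :
    ∃ ζ : ℂ, conj a = a * ζ ^ k ∧ conj b = b * ζ ^ l := by
  have ha : a ≠ 0 := by rintro rfl; simp at hμ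
  by_cases hb : b = 0
  · obtain ⟨ζ, hζ⟩ := IsAlgClosed.exists_pow_nat_eq (conj a / a) (Nat.pos_of_ne_zero hk)
    exact ⟨ζ, by rw [hζ, mul_div_cancel₀ _ ha], by simp [hb]⟩
  have hca : conj a ≠ 0 := (map_ne_zero _).2 ha
  have hcb : conj b ≠ 0 := (map_ne_zero _).2 hb
  have hμ' : conj (-a * μ ^ k) = 1 := by rw [hμ, map_one]
  have key : (conj b / b) ^ k = (conj a / a) ^ l := by
    have h1 : (-b * μ ^ l) ^ k * (-a) ^ l = (-b) ^ k := by
      rw [mul_pow, ← pow_mul, mul_comm l k, pow_mul, mul_assoc, ← mul_pow, mul_comm _ (-a), hμ,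
        one_pow, mul_one]
    have h2 := congrArg conj h1
    rw [map_mul, Complex.conj_eq_iff_im.2 him] at h2
    simp only [map_pow, map_neg] at h2
    have hne : (-b) ^ k ≠ 0 := pow_ne_zero _ (neg_ne_zero.2 hb)
    rw [← neg_div_neg_eq (conj b), ← neg_div_neg_eq (conj a), div_pow, div_pow,
      div_eq_div_iff hne (pow_ne_zero _ (neg_ne_zero.2 ha)), ← h2]
    linear_combination (-conj a) ^ l * h1
  obtain ⟨ζ, h1, h2⟩ := exists_pow_eq_and_pow_eq hcop (div_ne_zero hca ha) (div_ne_zero hcb hb) key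
  exact ⟨ζ, by rw [h1, mul_div_cancel₀ _ ha], by rw [h2, mul_div_cancel₀ _ hb]⟩

theorem theorem1p2 (A B : Polynomial ℂ) (hA : A ≠ 0) (hB : B ≠ 0)
    (hAB : 1 ≤ (A * B).natDegree) (k l : ℕ) (hl : 1 ≤ l) (hlk : l < k)
    (hcop : Nat.Coprime k l) (n : ℕ) (hP : genPoly A B k l n ≠ 0)
    (z₀ : ℂ) (hz₀ : (genPoly A B k l n).IsRoot z₀) (hAz₀ : A.eval z₀ ≠ 0) :
    ∃ t₁ t₂ : ℂ, t₁ ≠ t₂ ∧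
      (trinomialAt A B k l z₀).IsRoot t₁ ∧ (trinomialAt A B k l z₀).IsRoot t₂ ∧
      ((t₁ / t₂).im = 0 ∨ ‖t₁ / t₂‖ = 1) := by
  obtain ⟨μ, hμ⟩ := IsAlgClosed.exists_pow_nat_eq (-(A.eval z₀))⁻¹ (show 0 < k by omega)
  have hμ' : -A.eval z₀ * μ ^ k = 1 := by rw [hμ, mul_inv_cancel₀ (neg_ne_zero.2 hAz₀)]
  have him : ((-B.eval z₀ * μ ^ l) ^ k).im = 0 := by
    by_contra him
    exact hP (genPoly_eq_zero_of_isRoot hl hlk hcop hμ' him n hz₀)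
  obtain ⟨ζ, hζA, hζB⟩ := exists_conj_eq_mul_pow (by omega) hcop hμ' him
  obtain ⟨r, hr⟩ := IsAlgClosed.exists_root (trinomialAt A B k l z₀) (fun h => by
    have h0 : (trinomialAt A B k l z₀).natDegree = 0 := Polynomial.natDegree_eq_of_degree_eq_some h
    rw [natDegree_trinomialAt hlk hAz₀] at h0
    omega)
  by_cases h : ∃ s, (trinomialAt A B k l z₀).IsRoot s ∧ r ≠ s
  · obtain ⟨s, hs, hrs⟩ := h
    exact exists_roots_of_conj_eq (by omega) hAz₀ hζA hζB hrs hr hs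
  · push Not at h
    obtain ⟨rfl, hBr, hAr⟩ := eq_two_of_forall_root_eq hl hlk hAz₀ (fun s hs => (h s hs).symm)
    obtain rfl : l = 1 := by omega
    have h1 := eval_genPoly_two_one hBr hAr n
    rw [hz₀.eq_zero, zero_mul] at h1
    exact absurd h1.symm (Nat.cast_add_one_ne_zero n)
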